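/- Let $(\mathcal M,\langle\cdot,\cdot\rangle)$ be a smooth complete finite-dimensional Riemannian manifold without boundary, with Levi-Civita connection $\nabla$ and with $\|\cdot\|$ the norm on the tangent spaces; write $\nabla U$ for the gradient of a smooth function $U$, $\dot x$ for the velocity of a curve $x$, $\nabla_{\dot x}\dot x$ for the covariant derivative of the velocity along the curve, and $\|\xi(\cdot)\|_\infty:=\sup_{t\in\mathbb R}\|\xi(t)\|$ for a vector field $\xi$ along a curve defined on $\mathbb R$. The equation $\zeta^3-3\zeta-1=0$ has exactly one positive root $\zeta_0\approx1.879$, and there is an absolute constant $C$ with $0<C\le\zeta_0$ (independent of the manifold, the curve and the function $U$) such that the following holds. Let $x:\mathbb R\to\mathcal M$ be a smooth mapping with $\|\nabla_{\dot x}\dot x(\cdot)\|_\infty<\infty$, and suppose that there is a smooth function $U:\mathcal M\to\mathbb R$ with $$\sup_{t\in\mathbb R}U(x(t))<\infty,\qquad 0<\|\nabla U\circ x(\cdot)\|_\infty<\infty,$$ $$\lambda:=\inf_{t\in\mathbb R}\min\bigl\{\langle\nabla_\xi\nabla U(x(t)),\xi\rangle:\ \xi\in T_{x(t)}\mathcal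 M,\ \|\xi\|=1\bigr\}>0.$$ Then $\|\dot x(\cdot)\|_\infty<\infty$ and $$\|\dot x(\cdot)\|_\infty^2\le\frac{C^2}{\lambda}\,\|\nabla U\circ x(\cdot)\|_\infty\,\|\nabla_{\dot x}\dot x(\cdot)\|_\infty .$$ -/

import Mathlib

open scoped Manifold ContDiff

namespace RiemannCurve

noncomputable section

/-- The Christoffel symbols of the first kind of a metric tensor `G` on (an open part of) `E`: the
linear functional `u ↦ (D_v G(w, u) + D_w G(v, u) - D_u G(v, w)) / 2`, all derivatives at `y`. -/
def christoffelForm {E : Type*} [NormedAddCommGroup E] [NormedSpace ℝ E]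
    (G : E → E →L[ℝ] E →L[ℝ] ℝ) (y v w : E) : E →L[ℝ] ℝ :=
  let DG : E →L[ℝ] E →L[ℝ] E →L[ℝ] ℝ := fderiv ℝ G y
  (1 / 2 : ℝ) • (DG v w + DG w v - (DG.flip v).flip w)

theorem christoffelForm_apply {E : Type*} [NormedAddCommGroup E] [NormedSpace ℝ E]
    (G : E → E →L[ℝ] E →L[ℝ] ℝ) (y v w u : E) :
    christoffelForm G y v w u =
      (fderiv ℝ G y v w u + fderiv ℝ G y w v u - fderiv ℝ G y u v w) / 2 := by
  simp [christoffelForm]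
  ring

end

end RiemannCurve

open Bundle

namespace RiemannCurve

noncomputable section

variable {E : Type*} [NormedAddCommGroup E] [NormedSpace ℝ E]
  {M : Type*} [TopologicalSpace M] [ChartedSpace E M]
  [RiemannianBundle (fun (x : M) ↦ TangentSpace 𝓘(ℝ, E) x)]

/-- The metric tensor read in the chart `φ` at `p`: the bilinear form
`(v, w) ↦ ⟨(dφ⁻¹)_y v, (dφ⁻¹)_y w⟩` on `E`, as a function of `y` in the target of `φ`. -/
def chartMetric (p : M) (y : E) : E →L[ℝ] E →L[ℝ] ℝ :=
  let q : M := (extChartAt 𝓘(ℝ, E) p).symm y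
  let A : E →L[ℝ] TangentSpace 𝓘(ℝ, E) q :=
    mfderiv 𝓘(ℝ, E) 𝓘(ℝ, E) (extChartAt 𝓘(ℝ, E) p).symm y
  (innerSL ℝ (E := TangentSpace 𝓘(ℝ, E) q)).bilinearComp A A

theorem chartMetric_apply (p : M) (y v w : E) :
    chartMetric p y v w =
      inner ℝ (E := TangentSpace 𝓘(ℝ, E) ((extChartAt 𝓘(ℝ, E) p).symm y))
        (mfderiv 𝓘(ℝ, E) 𝓘(ℝ, E) (extChartAt 𝓘(ℝ, E) p).symm y v)
        (mfderiv 𝓘(ℝ, E) 𝓘(ℝ, E) (extChartAt 𝓘(ℝ, E) p).symm y w) :=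
  rfl

variable [FiniteDimensional ℝ E]

/-- The tangent vector at `p` which represents the linear functional `f` on the tangent space at
`p` through the Riemannian inner product: `⟨riesz p f, w⟩ = f w` for all `w`. -/
def riesz (p : M) (f : TangentSpace 𝓘(ℝ, E) p →L[ℝ] ℝ) : TangentSpace 𝓘(ℝ, E) p :=
  haveI : FiniteDimensional ℝ (TangentSpace 𝓘(ℝ, E) p) := inferInstanceAs (FiniteDimensional ℝ E)
  haveI : CompleteSpace (TangentSpace 𝓘(ℝ, E) p) := FiniteDimensional.complete ℝ _
  (InnerProductSpace.toDual ℝ (TangentSpace 𝓘(ℝ, E) p)).symm f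

theorem inner_riesz (p : M) (f : TangentSpace 𝓘(ℝ, E) p →L[ℝ] ℝ) (w : TangentSpace 𝓘(ℝ, E) p) :
    inner ℝ (riesz p f) w = f w := by
  have : FiniteDimensional ℝ (TangentSpace 𝓘(ℝ, E) p) := inferInstanceAs (FiniteDimensional ℝ E)
  have : CompleteSpace (TangentSpace 𝓘(ℝ, E) p) := FiniteDimensional.complete ℝ _
  exact InnerProductSpace.toDual_symm_apply

/-- The gradient of `U`: `⟨∇U(p), w⟩ = dU_p(w)`. -/
def grad (U : M → ℝ) (p : M) : TangentSpace 𝓘(ℝ, E) p :=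
  riesz p (mvfderiv 𝓘(ℝ, E) U p)

/-- The Christoffel symbols of the Levi-Civita connection in the chart `φ` at `p`, evaluated at
`p`: writing `G` for the metric tensor in this chart, `Γ(v, w)` is determined by
`⟨Γ(v, w), u⟩ = (D_v G(w, u) + D_w G(v, u) - D_u G(v, w)) / 2`.
The chart `φ` identifies `T_p M` with `E` (its derivative at `p` is the identity in Mathlib's
model of the tangent space). -/
def christoffel (p : M) (v w : TangentSpace 𝓘(ℝ, E) p) : TangentSpace 𝓘(ℝ, E) p :=
  riesz p (christoffelForm (E := E) (chartMetric p) (extChartAt 𝓘(ℝ, E) p p) v w)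

/-- The Levi-Civita covariant derivative `∇_ξ X (p)` of the vector field `X` at `p` in the direction
`ξ`: in the chart `φ` at `p` it is `D_ξ X + Γ(ξ, X)`, the field being read in the chart as
`y ↦ dφ (X (φ⁻¹ y))`. -/
def covDeriv (X : ∀ q : M, TangentSpace 𝓘(ℝ, E) q) (p : M) (ξ : TangentSpace 𝓘(ℝ, E) p) :
    TangentSpace 𝓘(ℝ, E) p :=
  let Xφ : E → E := fun y ↦
    mfderiv 𝓘(ℝ, E) 𝓘(ℝ, E) (extChartAt 𝓘(ℝ, E) p) ((extChartAt 𝓘(ℝ, E) p).symm y)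
      (X ((extChartAt 𝓘(ℝ, E) p).symm y))
  let dX : TangentSpace 𝓘(ℝ, E) p := fderiv ℝ Xφ (extChartAt 𝓘(ℝ, E) p p) ξ
  dX + christoffel p ξ (X p)

/-- The velocity `ẋ(t)` of a curve. -/
def velocity (x : ℝ → M) (t : ℝ) : TangentSpace 𝓘(ℝ, E) (x t) :=
  mfderiv 𝓘(ℝ, ℝ) 𝓘(ℝ, E) x t (1 : ℝ)

/-- The Levi-Civita covariant derivative `∇_ẋ ξ (t)` of a vector field `ξ` along the curve `x`: in
the chart `φ` at `x(t)` it is `ξ' + Γ(ẋ, ξ)`, the field being read in the chart as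
`s ↦ dφ (ξ(s))`. -/
def covDerivAlong (x : ℝ → M) (ξ : ∀ t : ℝ, TangentSpace 𝓘(ℝ, E) (x t)) (t : ℝ) :
    TangentSpace 𝓘(ℝ, E) (x t) :=
  let ξφ : ℝ → E := fun s ↦
    mfderiv 𝓘(ℝ, E) 𝓘(ℝ, E) (extChartAt 𝓘(ℝ, E) (x t)) (x s) (ξ s)
  let dξ : TangentSpace 𝓘(ℝ, E) (x t) := deriv ξφ t
  dξ + christoffel (x t) (velocity x t) (ξ t)

/-- The smallest value of the Hessian form `ξ ↦ ⟨∇_ξ ∇U (p), ξ⟩` on the unit sphere of `T_p M`. -/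
def minHessian (U : M → ℝ) (p : M) : ℝ :=
  sInf {r : ℝ | ∃ ξ : TangentSpace 𝓘(ℝ, E) p, ‖ξ‖ = 1 ∧
    r = inner ℝ (covDeriv (E := E) (grad (E := E) U) p ξ) ξ}

end

end RiemannCurve

open RiemannCurve

/-! Put f = U ∘ x, g = f' = ⟨∇U, ẋ⟩, v = ‖ẋ‖, and let A and B bound the acceleration and the
gradient along the curve. Metric compatibility makes v A-Lipschitz and gives g' ≥ λv² - AB; moreover
|g| ≤ Bv. Let m = √(AB/λ), the speed above which g must increase. Suppose g(t₀) ≥ 0 and v(t₀) = wm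
with w > ζ. Since v decays at rate at most A, integrating the bound on g' until v(t₀) - A(t - t₀)
reaches m gives g ≥ Bm(w³ - 3w + 2)/3, which exceeds Bm exactly when w³ - 3w - 1 > 0. From then on g
cannot fall back, because g > Bm forces v > m and so g' > 0. Thus f grows at least linearly,
although it is bounded above. If g(t₀) ≤ 0, reverse time. The scalar argument is `speed_sq_le`; its
geometric inputs are `hasDerivAt_inner_grad_velocity` and `hasDerivAt_norm_velocity_sq`. -/

/-! ### The cubic and its positive root. -/

theorem cubic_pos_of_lt {ζ w : ℝ} (hζ : 0 < ζ) (h : ζ ^ 3 - 3 * ζ - 1 = 0) (hw : ζ < w) :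
    0 < w ^ 3 - 3 * w - 1 := by
  have h1 : 1 < ζ := by
    by_contra! hc
    nlinarith [pow_le_one₀ hζ.le hc (n := 3)]
  have h2 : w ^ 3 - 3 * w - 1 = (w - ζ) * (w ^ 2 + w * ζ + ζ ^ 2 - 3) := by
    linear_combination h
  rw [h2]
  exact mul_pos (by linarith) (by nlinarith)

theorem exists_cubic_root :
    ∃ ζ : ℝ, 0 < ζ ∧ ζ ^ 3 - 3 * ζ - 1 = 0 ∧ (∀ z : ℝ, 0 < z → z ^ 3 - 3 * z - 1 = 0 → z = ζ) ∧
      |ζ - 1.879| < 0.0005 := by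
  have hc : ContinuousOn (fun z : ℝ ↦ z ^ 3 - 3 * z - 1) (Set.Icc 1.879 1.8794) := by fun_prop
  obtain ⟨ζ, ⟨h1, h2⟩, h3⟩ := intermediate_value_Icc (by norm_num) hc
    (show (0 : ℝ) ∈ Set.Icc _ _ by constructor <;> norm_num)
  have h3 : ζ ^ 3 - 3 * ζ - 1 = 0 := h3
  have h0 : 0 < ζ := by linarith
  refine ⟨ζ, h0, h3, fun z hz hz' ↦ ?_, ?_⟩
  · rcases lt_trichotomy z ζ with h | h | h
    · exact absurd h3 (cubic_pos_of_lt hz hz' h).ne'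
    · exact h
    · exact absurd hz' (cubic_pos_of_lt h0 h3 h).ne'
  · rw [abs_lt]; constructor <;> linarith

/-- A nonnegative function whose square has derivative at most `2 A` times the function is
`A`-Lipschitz. -/
theorem abs_sub_le_of_hasDerivAt_sq {v h' : ℝ → ℝ} {A : ℝ} (hA : 0 ≤ A) (hv : ∀ t, 0 ≤ v t)
    (hd : ∀ t, HasDerivAt (fun s ↦ v s ^ 2) (h' t) t) (hb : ∀ t, |h' t| ≤ 2 * (A * v t))
    (s t : ℝ) : |v s - v t| ≤ A * |s - t| := by
  -- v may fail to be differentiable at its zeros; √(v² + ε) is differentiable with the same slope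
  -- bound, and ε tends to 0.
  have key : ∀ ε : ℝ, 0 < ε →
      |√(v s ^ 2 + ε) - √(v t ^ 2 + ε)| ≤ A * |s - t| := by
    intro ε hε
    have hp : ∀ r, 0 < v r ^ 2 + ε := fun r ↦ by positivity
    have hder : ∀ r ∈ (Set.univ : Set ℝ), HasDerivWithinAt (fun r ↦ √(v r ^ 2 + ε))
        (h' r / (2 * √(v r ^ 2 + ε))) Set.univ r := fun r _ ↦
      (((hd r).add_const ε).sqrt (hp r).ne').hasDerivWithinAt
    have := convex_univ.norm_image_sub_le_of_norm_hasDerivWithin_le (C := A) hder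
      (fun r _ ↦ ?_) (Set.mem_univ t) (Set.mem_univ s)
    · simpa [Real.norm_eq_abs] using this
    · have hs : 0 < √(v r ^ 2 + ε) := Real.sqrt_pos.2 (hp r)
      have hvs : v r ≤ √(v r ^ 2 + ε) := Real.le_sqrt_of_sq_le (by linarith)
      rw [Real.norm_eq_abs, abs_div, abs_of_pos (by positivity : 0 < 2 * √(v r ^ 2 + ε)),
        div_le_iff₀ (by positivity)]
      nlinarith [hb r]
  have hlim : Filter.Tendsto (fun ε : ℝ ↦ |√(v s ^ 2 + ε) - √(v t ^ 2 + ε)|)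
      (nhdsWithin 0 (Set.Ioi 0)) (nhds |v s - v t|) := by
    have : Continuous (fun ε : ℝ ↦ |√(v s ^ 2 + ε) - √(v t ^ 2 + ε)|) := by fun_prop
    have h0 := this.tendsto 0
    simp only [add_zero, Real.sqrt_sq (hv s), Real.sqrt_sq (hv t)] at h0
    exact h0.mono_left nhdsWithin_le_nhds
  exact le_of_tendsto hlim (by filter_upwards [self_mem_nhdsWithin] with ε hε using key ε hε)

/-! ### The scalar comparison argument. -/

section Comparison

variable {f g g' v : ℝ → ℝ} {lam A B ζ : ℝ}

theorem not_bddAbove_of_le_deriv {c T : ℝ} (hc : 0 < c) (hf : ∀ t, HasDerivAt f (g t) t)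
    (hg : ∀ t, T ≤ t → c ≤ g t) : ¬ BddAbove (Set.range f) := by
  rintro ⟨K, hK⟩
  have hmono : MonotoneOn (fun t ↦ f t - c * t) (Set.Ici T) := by
    refine monotoneOn_of_hasDerivWithinAt_nonneg (convex_Ici T) (f' := fun t ↦ g t - c)
      (fun t _ ↦ ?_) (fun t _ ↦ ?_) (fun t ht ↦ ?_)
    · exact ((hf t).continuousAt.sub (by fun_prop)).continuousWithinAt
    · simpa using! ((hf t).sub ((hasDerivAt_id t).const_mul c)).hasDerivWithinAt
    · rw [interior_Ici] at ht
      linarith [hg t (le_of_lt ht)]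
  have hKT : f T ≤ K := hK ⟨T, rfl⟩
  -- At this time linear growth at rate c has carried f to K + 1.
  set t := T + (K - f T + 1) / c
  have ht : T ≤ t := le_add_of_nonneg_right (div_nonneg (by linarith) hc.le)
  have h1 := hmono (Set.mem_Ici.2 le_rfl) (Set.mem_Ici.2 ht) ht
  have h2 : c * t = c * T + (K - f T + 1) := by simp only [t]; field_simp
  have h3 : f t ≤ K := hK ⟨t, rfl⟩
  simp only at h1
  linarith

theorem speed_sq_le_of_deriv_nonneg (hlam : 0 < lam) (hA : 0 < A) (hB : 0 < B)
    (hζ : 0 < ζ) (hroot : ζ ^ 3 - 3 * ζ - 1 = 0)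
    (hlip : ∀ s t, |v s - v t| ≤ A * |s - t|)
    (hf : ∀ t, HasDerivAt f (g t) t) (hg : ∀ t, HasDerivAt g (g' t) t)
    (hgv : ∀ t, |g t| ≤ B * v t) (hg' : ∀ t, lam * v t ^ 2 - A * B ≤ g' t)
    (hbdd : BddAbove (Set.range f)) {t₀ : ℝ} (ht₀ : 0 ≤ g t₀) :
    lam * v t₀ ^ 2 ≤ ζ ^ 2 * (A * B) := by
  by_contra! hlt
  have hv : ∀ t, 0 ≤ v t := fun t ↦
    nonneg_of_mul_nonneg_right ((abs_nonneg _).trans (hgv t)) hB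
  -- The speed at which the lower bound λv² - AB for g' vanishes.
  set m := √(A * B / lam) with hm
  have hm0 : 0 < m := Real.sqrt_pos.2 (by positivity)
  have hm2 : lam * m ^ 2 = A * B := by
    rw [hm, Real.sq_sqrt (by positivity)]; field_simp
  have hζ1 : 1 < ζ := by
    by_contra! hc
    nlinarith [pow_le_one₀ hζ.le hc (n := 3)]
  have hvm : ζ * m < v t₀ := by
    refine lt_of_pow_lt_pow_left₀ 2 (hv _) ?_
    rw [← hm2] at hlt
    have : lam * (ζ * m) ^ 2 < lam * v t₀ ^ 2 := by linarith [mul_pow ζ m 2]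
    exact lt_of_mul_lt_mul_left this hlam.le
  have hvm' : m < v t₀ := by nlinarith
  -- The time at which the guaranteed speed v t₀ - A(t - t₀) has dropped to m.
  set T := t₀ + (v t₀ - m) / A with hT
  have hAT : A * (T - t₀) = v t₀ - m := by rw [hT]; field_simp; ring
  have ht₀T : t₀ ≤ T := by rw [hT]; linarith [div_pos (sub_pos.2 hvm') hA]
  -- The term added to g is minus a primitive of λ(v t₀ - A(t - t₀))² - AB, so monotonicity is the
  -- integrated bound on g'.
  have hmono : MonotoneOn
      (fun t ↦ g t + (lam * (v t₀ - A * (t - t₀)) ^ 3 / (3 * A) + A * B * t)) (Set.Icc t₀ T) := by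
    refine monotoneOn_of_hasDerivWithinAt_nonneg (convex_Icc t₀ T)
      (f' := fun t ↦ g' t + (-(lam * (v t₀ - A * (t - t₀)) ^ 2) + A * B))
      (fun t _ ↦ ?_) (fun t _ ↦ ?_) (fun t ht ↦ ?_)
    · exact ((hg t).continuousAt.add (by fun_prop)).continuousWithinAt
    · have h1 : HasDerivAt (fun t ↦ v t₀ - A * (t - t₀)) (-A) t := by
        simpa using (((hasDerivAt_id t).sub_const t₀).const_mul A).const_sub (v t₀)
      have h2 := (((h1.pow 3).const_mul lam).div_const (3 * A)).add
        ((hasDerivAt_id t).const_mul (A * B))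
      refine ((hg t).add (h2.congr_deriv ?_)).hasDerivWithinAt
      simp
      field_simp
    · rw [interior_Icc] at ht
      have h1 := hlip t₀ t
      rw [abs_sub_comm t₀ t, abs_of_pos (sub_pos.2 ht.1)] at h1
      have h2 : v t₀ - A * (t - t₀) ≤ v t := by linarith [le_abs_self (v t₀ - v t)]
      have h3 : 0 ≤ v t₀ - A * (t - t₀) := by
        have := mul_lt_mul_of_pos_left (sub_lt_sub_right ht.2 t₀) hA
        linarith
      have h4 := mul_le_mul_of_nonneg_left (pow_le_pow_left₀ h3 h2 2) hlam.le
      linarith [hg' t]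
  have hgT := hmono (Set.left_mem_Icc.2 ht₀T) (Set.right_mem_Icc.2 ht₀T) ht₀T
  simp only [hAT, sub_self, mul_zero, sub_zero, sub_sub_cancel] at hgT
  -- With w = v t₀ / m the gain is Bm(w³ - 1)/3 - Bm(w - 1); comparing it with Bm produces the
  -- cubic.
  have hc : B * m < g T := by
    have hw : ζ < v t₀ / m := (lt_div_iff₀ hm0).2 hvm
    have hpos := cubic_pos_of_lt hζ hroot hw
    set w := v t₀ / m with hwdef
    have hvw : v t₀ = w * m := by rw [hwdef]; field_simp
    have hlamA : lam = A * B / m ^ 2 := by rw [← hm2]; field_simp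
    have h1 : lam * v t₀ ^ 3 / (3 * A) - lam * m ^ 3 / (3 * A) = B * m * (w ^ 3 - 1) / 3 := by
      rw [hvw, hlamA]; field_simp
    have h2 : A * B * T - A * B * t₀ = B * (v t₀ - m) := by rw [← hAT]; ring
    rw [hvw] at h2
    nlinarith [mul_pos (mul_pos hB hm0) hpos]
  refine not_bddAbove_of_le_deriv (c := g T) (T := T) ((mul_pos hB hm0).trans hc) hf
    (fun t ht ↦ ?_) hbdd
  -- Barrier argument: wherever g returns to the value g T > Bm, the bound g ≤ Bv forces v > m, so g
  -- is strictly increasing there.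
  have := image_le_of_deriv_right_lt_deriv_boundary (f := fun t ↦ -g t) (f' := fun t ↦ -g' t)
    (a := T) (b := t) (B := fun _ ↦ -g T) (B' := fun _ ↦ 0)
    (fun s _ ↦ (hg s).continuousAt.neg.continuousWithinAt) (fun s _ ↦ (hg s).neg.hasDerivWithinAt)
    le_rfl (fun s ↦ hasDerivAt_const s _) (fun s _ hs ↦ ?_) (Set.right_mem_Icc.2 ht)
  · exact neg_le_neg_iff.1 this
  · have h1 : g s = g T := neg_injective hs
    have h2 : m < v s := by
      have := (le_abs_self _).trans (hgv s)
      rw [h1] at this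
      exact lt_of_mul_lt_mul_left (hc.trans_le this) hB.le
    have h3 := mul_lt_mul_of_pos_left (pow_lt_pow_left₀ h2 hm0.le two_ne_zero) hlam
    linarith [hg' s]

theorem speed_sq_le (hlam : 0 < lam) (hA : 0 < A) (hB : 0 < B)
    (hζ : 0 < ζ) (hroot : ζ ^ 3 - 3 * ζ - 1 = 0)
    (hlip : ∀ s t, |v s - v t| ≤ A * |s - t|)
    (hf : ∀ t, HasDerivAt f (g t) t) (hg : ∀ t, HasDerivAt g (g' t) t)
    (hgv : ∀ t, |g t| ≤ B * v t) (hg' : ∀ t, lam * v t ^ 2 - A * B ≤ g' t)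
    (hbdd : BddAbove (Set.range f)) (t : ℝ) :
    lam * v t ^ 2 ≤ ζ ^ 2 * (A * B) := by
  rcases le_total 0 (g t) with h | h
  · exact speed_sq_le_of_deriv_nonneg hlam hA hB hζ hroot hlip hf hg hgv hg' hbdd h
  -- Time reversal flips the sign of g and preserves every hypothesis.
  · have := speed_sq_le_of_deriv_nonneg (f := fun s ↦ f (-s)) (g := fun s ↦ -g (-s))
      (g' := fun s ↦ g' (-s)) (v := fun s ↦ v (-s)) (t₀ := -t) hlam hA hB hζ hroot
      (fun a b ↦ (hlip _ _).trans_eq ?_) (fun s ↦ ?_) (fun s ↦ ?_) (fun s ↦ by simpa using hgv (-s))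
      (fun s ↦ hg' _) (hbdd.mono ?_) (by simpa using h)
    · simpa using this
    · rw [show -a - -b = -(a - b) by ring, abs_neg]
    · simpa using! (hf (-s)).scomp s (hasDerivAt_neg s)
    · simpa using! ((hg (-s)).scomp s (hasDerivAt_neg s)).neg
    · rintro _ ⟨s, rfl⟩
      exact ⟨-s, rfl⟩

end Comparison

/-! ### Christoffel symbols of a metric tensor on a vector space. -/

section

variable {E : Type*} [NormedAddCommGroup E] [NormedSpace ℝ E] {G : E → E →L[ℝ] E →L[ℝ] ℝ}

theorem hasDerivAt_comp_of_differentiableAt {F : Type*} [NormedAddCommGroup F] [NormedSpace ℝ F]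
    {G : E → E →L[ℝ] F} {y : ℝ → E} {y' : E} {t : ℝ} (hG : DifferentiableAt ℝ G (y t))
    (hy : HasDerivAt y y' t) : HasDerivAt (fun s ↦ G (y s)) (fderiv ℝ G (y t) y') t :=
  hG.hasFDerivAt.comp_hasDerivAt t hy

theorem hasDerivAt_bilin_comp {y a b : ℝ → E} {y' a' b' : E} {t : ℝ}
    (hG : DifferentiableAt ℝ G (y t)) (hy : HasDerivAt y y' t) (ha : HasDerivAt a a' t)
    (hb : HasDerivAt b b' t) :
    HasDerivAt (fun s ↦ G (y s) (a s) (b s))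
      (fderiv ℝ G (y t) y' (a t) (b t) + G (y t) a' (b t) + G (y t) (a t) b') t := by
  have h1 : HasDerivAt (fun s ↦ G (y s)) (fderiv ℝ G (y t) y') t :=
    hasDerivAt_comp_of_differentiableAt hG hy
  have h2 := (h1.clm_apply ha).clm_apply hb
  exact h2.congr_deriv (by simp)

theorem fderiv_bilin_comm {y : E} (hG : DifferentiableAt ℝ G y)
    (hs : ∀ z v w, G z v w = G z w v) (u v w : E) :
    fderiv ℝ G y u v w = fderiv ℝ G y u w v := by
  have h1 : ∀ v w, HasFDerivAt (fun z ↦ G z v w) _ y := fun v w ↦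
    (hG.hasFDerivAt.clm_apply (hasFDerivAt_const v _)).clm_apply (hasFDerivAt_const w _)
  have h2 := (h1 v w).unique ((h1 w v).congr_of_eventuallyEq (.of_forall fun z ↦ hs z v w))
  simpa using congrArg (fun L ↦ L u) h2

/-- The Christoffel symbols of a metric tensor are compatible with it. -/
theorem christoffelForm_add {y : E} (hG : DifferentiableAt ℝ G y)
    (hs : ∀ z v w, G z v w = G z w v) (u v w : E) :
    christoffelForm G y u v w + christoffelForm G y u w v = fderiv ℝ G y u v w := by
  rw [christoffelForm_apply, christoffelForm_apply]
  linarith [fderiv_bilin_comm hG hs u v w, fderiv_bilin_comm hG hs v u w,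
    fderiv_bilin_comm hG hs w u v]

end

namespace RiemannCurve

variable {E : Type*} [NormedAddCommGroup E] [NormedSpace ℝ E]
  {M : Type*} [TopologicalSpace M] [ChartedSpace E M]

/-! ### Charts and coordinates of vector fields along curves. -/

section Chart

variable [IsManifold 𝓘(ℝ, E) ∞ M]

theorem mfderiv_extChartAt_symm_comp {p q : M} (hq : q ∈ (extChartAt 𝓘(ℝ, E) p).source)
    (v : TangentSpace 𝓘(ℝ, E) q) :
    mfderiv 𝓘(ℝ, E) 𝓘(ℝ, E) (extChartAt 𝓘(ℝ, E) p).symm (extChartAt 𝓘(ℝ, E) p q)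
      (mfderiv 𝓘(ℝ, E) 𝓘(ℝ, E) (extChartAt 𝓘(ℝ, E) p) q v) = v := by
  have := mfderivWithin_extChartAt_symm_comp_mfderiv_extChartAt' (I := 𝓘(ℝ, E)) hq
  simp only [modelWithCornersSelf_coe, Set.range_id, mfderivWithin_univ] at this
  exact congrArg (fun L ↦ L v) this

theorem mfderiv_extChartAt_comp_symm {p : M} {y : E} (hy : y ∈ (extChartAt 𝓘(ℝ, E) p).target)
    (v : E) :
    mfderiv 𝓘(ℝ, E) 𝓘(ℝ, E) (extChartAt 𝓘(ℝ, E) p) ((extChartAt 𝓘(ℝ, E) p).symm y)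
      (mfderiv 𝓘(ℝ, E) 𝓘(ℝ, E) (extChartAt 𝓘(ℝ, E) p).symm y v) = v := by
  have := mfderiv_extChartAt_comp_mfderivWithin_extChartAt_symm (I := 𝓘(ℝ, E)) hy
  simp only [modelWithCornersSelf_coe, Set.range_id, mfderivWithin_univ] at this
  exact congrArg (fun L ↦ L v) this

/-- The tangent space at p is modelled on E through the preferred chart at p, so the coordinate
change involved is the identity. Formulas in the chart at x t therefore need no transition map at x
t itself. -/
theorem mfderiv_extChartAt_self (p : M) (v : TangentSpace 𝓘(ℝ, E) p) :
    mfderiv 𝓘(ℝ, E) 𝓘(ℝ, E) (extChartAt 𝓘(ℝ, E) p) p v = v := by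
  have h := mfderiv_chartAt_eq_tangentCoordChange (I := 𝓘(ℝ, E)) (mem_chart_source E p)
  have h2 : (extChartAt 𝓘(ℝ, E) p : M → E) = chartAt E p := by simp
  rw [h2, h]
  exact tangentCoordChange_self (I := 𝓘(ℝ, E)) (mem_extChartAt_source p)

/-- The coordinates of a vector field along a curve, in the chart at `p`. -/
noncomputable def chartFieldAlong (p : M) (x : ℝ → M) (ξ : ∀ t : ℝ, TangentSpace 𝓘(ℝ, E) (x t))
    (s : ℝ) : E :=
  mfderiv 𝓘(ℝ, E) 𝓘(ℝ, E) (extChartAt 𝓘(ℝ, E) p) (x s) (ξ s)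

theorem hasDerivAt_extChartAt_comp {p : M} {x : ℝ → M} {t : ℝ}
    (hx : MDifferentiableAt 𝓘(ℝ, ℝ) 𝓘(ℝ, E) x t) (ht : x t ∈ (extChartAt 𝓘(ℝ, E) p).source) :
    HasDerivAt (fun s ↦ extChartAt 𝓘(ℝ, E) p (x s)) (chartFieldAlong p x (velocity x) t) t := by
  have h1 : MDifferentiableAt 𝓘(ℝ, E) 𝓘(ℝ, E) (extChartAt 𝓘(ℝ, E) p) (x t) :=
    mdifferentiableAt_extChartAt (by simpa using ht)
  have h2 : HasMFDerivAt 𝓘(ℝ, ℝ) 𝓘(ℝ, E) (fun s ↦ extChartAt 𝓘(ℝ, E) p (x s)) t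
      ((mfderiv 𝓘(ℝ, E) 𝓘(ℝ, E) (extChartAt 𝓘(ℝ, E) p) (x t)).comp
        (mfderiv 𝓘(ℝ, ℝ) 𝓘(ℝ, E) x t)) := h1.hasMFDerivAt.comp t hx.hasMFDerivAt
  have h3 : HasFDerivAt (fun s ↦ extChartAt 𝓘(ℝ, E) p (x s)) (_ : ℝ →L[ℝ] E) t :=
    hasMFDerivAt_iff_hasFDerivAt.1 h2
  exact h3.hasDerivAt

end Chart

variable [RiemannianBundle (fun (x : M) ↦ TangentSpace 𝓘(ℝ, E) x)]

/-! ### The metric in a chart and metric compatibility. -/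

section Metric

variable [IsManifold 𝓘(ℝ, E) ∞ M]

theorem chartMetric_mfderiv {p q : M} (hq : q ∈ (extChartAt 𝓘(ℝ, E) p).source)
    (v w : TangentSpace 𝓘(ℝ, E) q) :
    chartMetric p (extChartAt 𝓘(ℝ, E) p q)
      (mfderiv 𝓘(ℝ, E) 𝓘(ℝ, E) (extChartAt 𝓘(ℝ, E) p) q v)
      (mfderiv 𝓘(ℝ, E) 𝓘(ℝ, E) (extChartAt 𝓘(ℝ, E) p) q w) = inner ℝ v w := by
  -- `chartMetric` uses the tangent space at φ⁻¹(φ q), equal to that at q only propositionally;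
  -- writing q as φ⁻¹ y avoids a transport.
  obtain ⟨y, hy, rfl⟩ : ∃ y ∈ (extChartAt 𝓘(ℝ, E) p).target, (extChartAt 𝓘(ℝ, E) p).symm y = q :=
    ⟨_, (extChartAt 𝓘(ℝ, E) p).map_source hq, (extChartAt 𝓘(ℝ, E) p).left_inv hq⟩
  have key := mfderiv_extChartAt_symm_comp hq
  rw [(extChartAt 𝓘(ℝ, E) p).right_inv hy] at key ⊢
  exact (chartMetric_apply p y _ _).trans (congrArg₂ (inner ℝ) (key v) (key w))

theorem chartMetric_self (p : M) (v w : TangentSpace 𝓘(ℝ, E) p) :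
    chartMetric p (extChartAt 𝓘(ℝ, E) p p) v w = inner ℝ v w := by
  have := chartMetric_mfderiv (mem_extChartAt_source (I := 𝓘(ℝ, E)) p) v w
  rwa [mfderiv_extChartAt_self, mfderiv_extChartAt_self] at this

omit [IsManifold 𝓘(ℝ, E) ∞ M] in
theorem chartMetric_comm (p : M) (y v w : E) : chartMetric p y v w = chartMetric p y w v := by
  rw [chartMetric_apply, chartMetric_apply]
  exact real_inner_comm _ _

/-- Each coordinate field dφ⁻¹ v is a smooth section, so its inner products with the others are
smooth; in finite dimension smoothness of a bilinear form can be tested on fixed vectors. -/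
theorem contDiffOn_chartMetric [FiniteDimensional ℝ E]
    [IsContMDiffRiemannianBundle 𝓘(ℝ, E) ∞ E (fun (p : M) ↦ TangentSpace 𝓘(ℝ, E) p)] (p : M) :
    ContDiffOn ℝ ∞ (chartMetric (E := E) p) (extChartAt 𝓘(ℝ, E) p).target := by
  have hsec : ∀ v : E, ContMDiffOn 𝓘(ℝ, E) (𝓘(ℝ, E).prod 𝓘(ℝ, E)) ∞
      (fun y ↦ (⟨(extChartAt 𝓘(ℝ, E) p).symm y,
        mfderiv 𝓘(ℝ, E) 𝓘(ℝ, E) (extChartAt 𝓘(ℝ, E) p).symm y v⟩ : TangentBundle 𝓘(ℝ, E) M))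
      (extChartAt 𝓘(ℝ, E) p).target := by
    intro v
    have h1 : ContMDiff 𝓘(ℝ, E) (𝓘(ℝ, E).prod 𝓘(ℝ, E)) ∞
        (fun y : E ↦ (⟨y, v⟩ : TangentBundle 𝓘(ℝ, E) E)) :=
      contMDiff_vectorSpace_iff_contDiff.2 contDiff_const
    have h2 := (contMDiffOn_extChartAt_symm (I := 𝓘(ℝ, E)) (n := ∞) p).contMDiffOn_tangentMapWithin
      (m := ∞) le_rfl (isOpen_extChartAt_target p).uniqueMDiffOn
    refine (h2.comp h1.contMDiffOn fun y hy ↦ hy).congr fun y hy ↦ ?_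
    simp only [Function.comp_apply, tangentMapWithin]
    rw [mfderivWithin_of_isOpen (isOpen_extChartAt_target p) hy]
  rw [contDiffOn_clm_apply]
  intro v
  rw [contDiffOn_clm_apply]
  intro w
  rw [← contMDiffOn_iff_contDiffOn]
  exact ContMDiffOn.inner_bundle (E := fun q : M ↦ TangentSpace 𝓘(ℝ, E) q) (hsec v) (hsec w)

variable [FiniteDimensional ℝ E]
  [IsContMDiffRiemannianBundle 𝓘(ℝ, E) ∞ E (fun (p : M) ↦ TangentSpace 𝓘(ℝ, E) p)]

theorem contDiffAt_chartMetric (p : M) :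
    ContDiffAt ℝ ∞ (chartMetric (E := E) p) (extChartAt 𝓘(ℝ, E) p p) :=
  (contDiffOn_chartMetric p).contDiffAt (extChartAt_target_mem_nhds p)

theorem differentiableAt_chartMetric (p : M) :
    DifferentiableAt ℝ (chartMetric (E := E) p) (extChartAt 𝓘(ℝ, E) p p) :=
  (contDiffAt_chartMetric p).differentiableAt (by simp)

omit [IsManifold 𝓘(ℝ, E) ∞ M]
  [IsContMDiffRiemannianBundle 𝓘(ℝ, E) ∞ E (fun (p : M) ↦ TangentSpace 𝓘(ℝ, E) p)] in
theorem inner_christoffel (p : M) (u v w : TangentSpace 𝓘(ℝ, E) p) :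
    inner ℝ (christoffel p u v) w =
      christoffelForm (E := E) (chartMetric p) (extChartAt 𝓘(ℝ, E) p p) u v w :=
  inner_riesz p _ w

/-- The Christoffel symbols are compatible with the metric. -/
theorem inner_christoffel_add (p : M) (u v w : TangentSpace 𝓘(ℝ, E) p) :
    inner ℝ (christoffel p u v) w + inner ℝ v (christoffel p u w) =
      fderiv ℝ (chartMetric (E := E) p) (extChartAt 𝓘(ℝ, E) p p) u v w := by
  have h := christoffelForm_add (E := E) (differentiableAt_chartMetric (E := E) p)
    (chartMetric_comm (E := E) p) u v w
  rw [← inner_christoffel p u v w, ← inner_christoffel p u w v] at h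
  rw [← h, real_inner_comm v]

/-- Metric compatibility of the covariant derivative along a curve. -/
theorem hasDerivAt_inner_along {x : ℝ → M} {t : ℝ} {ξ η : ∀ t : ℝ, TangentSpace 𝓘(ℝ, E) (x t)}
    (hx : MDifferentiableAt 𝓘(ℝ, ℝ) 𝓘(ℝ, E) x t)
    (hξ : DifferentiableAt ℝ (chartFieldAlong (x t) x ξ) t)
    (hη : DifferentiableAt ℝ (chartFieldAlong (x t) x η) t) :
    HasDerivAt (fun s ↦ inner ℝ (ξ s) (η s))
      (inner ℝ (covDerivAlong x ξ t) (η t) + inner ℝ (ξ t) (covDerivAlong x η t)) t := by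
  have hy := hasDerivAt_extChartAt_comp hx (mem_extChartAt_source (I := 𝓘(ℝ, E)) (x t))
  have h := hasDerivAt_bilin_comp (differentiableAt_chartMetric (E := E) (x t)) hy
    hξ.hasDerivAt hη.hasDerivAt
  have hev : (fun s ↦ inner ℝ (ξ s) (η s)) =ᶠ[nhds t] fun s ↦
      chartMetric (x t) (extChartAt 𝓘(ℝ, E) (x t) (x s)) (chartFieldAlong (x t) x ξ s)
        (chartFieldAlong (x t) x η s) := by
    filter_upwards [hx.continuousAt.preimage_mem_nhds (extChartAt_source_mem_nhds (I := 𝓘(ℝ, E)) (x t))]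
      with s hs
    exact (chartMetric_mfderiv hs _ _).symm
  refine (h.congr_of_eventuallyEq hev).congr_deriv ?_
  have e : ∀ ζ : ∀ t : ℝ, TangentSpace 𝓘(ℝ, E) (x t), chartFieldAlong (x t) x ζ t = ζ t :=
    fun ζ ↦ mfderiv_extChartAt_self _ _
  have hc := inner_christoffel_add (x t) (velocity x t) (ξ t) (η t)
  -- Each derivative is named both in E and in the tangent space, so that rewriting does not mix
  -- their two normed structures.
  obtain ⟨a, ha⟩ : ∃ a : E, a = deriv (chartFieldAlong (x t) x ξ) t := ⟨_, rfl⟩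
  obtain ⟨b, hb⟩ : ∃ b : E, b = deriv (chartFieldAlong (x t) x η) t := ⟨_, rfl⟩
  obtain ⟨a', ha'⟩ : ∃ a' : TangentSpace 𝓘(ℝ, E) (x t), a' = a := ⟨_, rfl⟩
  obtain ⟨b', hb'⟩ : ∃ b' : TangentSpace 𝓘(ℝ, E) (x t), b' = b := ⟨_, rfl⟩
  have h1 := chartMetric_self (x t) a' (η t)
  have h2 := chartMetric_self (x t) (ξ t) b'
  have d1 : covDerivAlong x ξ t = a' + christoffel (x t) (velocity x t) (ξ t) := by
    rw [ha', ha]; rfl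
  have d2 : covDerivAlong x η t = b' + christoffel (x t) (velocity x t) (η t) := by
    rw [hb', hb]; rfl
  rw [d1, d2, inner_add_left, inner_add_right, ← h1, ← h2, ← ha, ← hb, ← ha', ← hb', e ξ, e η,
    e (velocity x)]
  linarith

end Metric


/-! ### Linear algebra with parameters. -/

section

variable {E : Type*} [NormedAddCommGroup E] [NormedSpace ℝ E] [FiniteDimensional ℝ E]

/-- The hypothesis makes B injective into the dual, which has the same finite dimension. -/
theorem isInvertible_of_apply_self_eq_zero {B : E →L[ℝ] E →L[ℝ] ℝ}
    (hB : ∀ v, B v v = 0 → v = 0) : B.IsInvertible := by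
  have hinj : Function.Injective (B : E →ₗ[ℝ] E →L[ℝ] ℝ) := by
    rw [injective_iff_map_eq_zero]
    intro v hv
    exact hB v (by simpa using congrArg (fun L : E →L[ℝ] ℝ ↦ L v) hv)
  have hdim : Module.finrank ℝ E = Module.finrank ℝ (E →L[ℝ] ℝ) := by
    rw [← (LinearMap.toContinuousLinearMap (𝕜 := ℝ) (E := E) (F' := ℝ)).finrank_eq]
    exact (Subspace.dual_finrank_eq (K := ℝ) (V := E)).symm
  exact ⟨(LinearEquiv.ofBijective (B : E →ₗ[ℝ] E →L[ℝ] ℝ) ⟨hinj,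
    (LinearMap.injective_iff_surjective_of_finrank_eq_finrank hdim).1
      hinj⟩).toContinuousLinearEquiv, by ext; rfl⟩

/-- The solution of a linear equation depends differentiably on parameters. -/
theorem differentiableAt_of_clm_apply_eq {F : Type*} [NormedAddCommGroup F] [NormedSpace ℝ F]
    {G : E → E →L[ℝ] F} {ℓ : E → F} {X : E → E} {y : E} (hG : DifferentiableAt ℝ G y)
    (hℓ : DifferentiableAt ℝ ℓ y) (hinv : ∀ᶠ z in nhds y, (G z).IsInvertible)
    (hX : ∀ᶠ z in nhds y, G z (X z) = ℓ z) : DifferentiableAt ℝ X y := by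
  have : CompleteSpace E := FiniteDimensional.complete ℝ E
  have h1 : DifferentiableAt ℝ ContinuousLinearMap.inverse (G y) :=
    hinv.self_of_nhds.contDiffAt_map_inverse.differentiableAt (n := 1) one_ne_zero
  have h2 : DifferentiableAt ℝ (fun z ↦ (G z).inverse) y := DifferentiableAt.comp y h1 hG
  refine (h2.clm_apply hℓ).congr_of_eventuallyEq ?_
  filter_upwards [hinv, hX] with z hz hXz
  exact (hz.inverse_apply_eq.2 hXz.symm).symm

omit [FiniteDimensional ℝ E] in
theorem clm_apply_smul_apply {F : Type*} [NormedAddCommGroup F] [NormedSpace ℝ F]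
    (D : E →L[ℝ] E →L[ℝ] F) (c : ℝ) (v w : E) : D (c • v) w = c • D v w := by
  rw [map_smul]
  rfl

omit [FiniteDimensional ℝ E] in
theorem christoffelForm_smul (G : E → E →L[ℝ] E →L[ℝ] ℝ) (y : E) (c : ℝ) (v w u : E) :
    christoffelForm G y (c • v) w u = c * christoffelForm G y v w u := by
  rw [christoffelForm_apply, christoffelForm_apply]
  have h : ∀ D : E →L[ℝ] E →L[ℝ] E →L[ℝ] ℝ, D (c • v) w u = c * D v w u ∧
      D w (c • v) u = c * D w v u ∧ D u (c • v) w = c * D u v w := fun D ↦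
    ⟨congrArg (fun L : E →L[ℝ] ℝ ↦ L u) (clm_apply_smul_apply (F := E →L[ℝ] ℝ) D c v w),
      clm_apply_smul_apply (F := ℝ) (D w) c v u, clm_apply_smul_apply (F := ℝ) (D u) c v w⟩
  rw [(h _).1, (h _).2.1, (h _).2.2]
  ring

end

/-! ### Velocity, gradient and Hessian along a curve. -/

variable {E : Type*} [NormedAddCommGroup E] [NormedSpace ℝ E]
  {M : Type*} [TopologicalSpace M] [ChartedSpace E M] [IsManifold 𝓘(ℝ, E) ∞ M]

/-- Near t these coordinates are the ordinary derivative of the smooth map φ ∘ x. -/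
theorem differentiableAt_chartFieldAlong_velocity {x : ℝ → M}
    (hx : ContMDiff 𝓘(ℝ, ℝ) 𝓘(ℝ, E) ∞ x) (t : ℝ) :
    DifferentiableAt ℝ (chartFieldAlong (x t) x (velocity (E := E) x)) t := by
  have hmd : MDifferentiable 𝓘(ℝ, ℝ) 𝓘(ℝ, E) x := hx.mdifferentiable (by simp)
  have h1 : ContMDiffAt 𝓘(ℝ, ℝ) 𝓘(ℝ, E) ∞ (fun s ↦ extChartAt 𝓘(ℝ, E) (x t) (x s)) t :=
    (contMDiffAt_extChartAt (I := 𝓘(ℝ, E)) (n := ∞) (x := x t)).comp t (hx t)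
  have h2 : ContDiffAt ℝ ∞ (fun s ↦ extChartAt 𝓘(ℝ, E) (x t) (x s)) t :=
    contMDiffAt_iff_contDiffAt.1 h1
  have h3 : DifferentiableAt ℝ (deriv fun s ↦ extChartAt 𝓘(ℝ, E) (x t) (x s)) t :=
    ((h2.fderiv_right (m := ∞) le_rfl).differentiableAt (by simp)).clm_apply
      (differentiableAt_const (1 : ℝ))
  refine h3.congr_of_eventuallyEq ?_
  filter_upwards [hx.continuous.continuousAt.preimage_mem_nhds
    (extChartAt_source_mem_nhds (I := 𝓘(ℝ, E)) (x t))] with s hs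
  exact (hasDerivAt_extChartAt_comp (hmd s) hs).deriv.symm

/-- The coordinates of a vector field in the chart at `p`. -/
noncomputable def chartField (X : ∀ q : M, TangentSpace 𝓘(ℝ, E) q) (p : M) (y : E) : E :=
  mfderiv 𝓘(ℝ, E) 𝓘(ℝ, E) (extChartAt 𝓘(ℝ, E) p) ((extChartAt 𝓘(ℝ, E) p).symm y)
    (X ((extChartAt 𝓘(ℝ, E) p).symm y))

omit [IsManifold 𝓘(ℝ, E) ∞ M] in
theorem chartFieldAlong_comp_eventuallyEq {X : ∀ q : M, TangentSpace 𝓘(ℝ, E) q} {x : ℝ → M} {t : ℝ}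
    (hx : ContinuousAt x t) :
    chartFieldAlong (x t) x (fun s ↦ X (x s)) =ᶠ[nhds t]
      fun s ↦ chartField X (x t) (extChartAt 𝓘(ℝ, E) (x t) (x s)) := by
  filter_upwards [hx.preimage_mem_nhds (extChartAt_source_mem_nhds (I := 𝓘(ℝ, E)) (x t))] with s hs
  exact congrArg (fun q ↦ (mfderiv 𝓘(ℝ, E) 𝓘(ℝ, E) (extChartAt 𝓘(ℝ, E) (x t)) q (X q) : E))
    ((extChartAt 𝓘(ℝ, E) (x t)).left_inv hs).symm

theorem hasDerivAt_chartFieldAlong_comp {X : ∀ q : M, TangentSpace 𝓘(ℝ, E) q} {x : ℝ → M} {t : ℝ}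
    (hx : MDifferentiableAt 𝓘(ℝ, ℝ) 𝓘(ℝ, E) x t)
    (hX : DifferentiableAt ℝ (chartField X (x t)) (extChartAt 𝓘(ℝ, E) (x t) (x t))) :
    HasDerivAt (chartFieldAlong (x t) x (fun s ↦ X (x s)))
      (fderiv ℝ (chartField X (x t)) (extChartAt 𝓘(ℝ, E) (x t) (x t)) (velocity (E := E) x t)) t := by
  have hy := hasDerivAt_extChartAt_comp hx (mem_extChartAt_source (I := 𝓘(ℝ, E)) (x t))
  have h := hX.hasFDerivAt.comp_hasDerivAt t hy
  have e : chartFieldAlong (E := E) (x t) x (velocity x) t = velocity (E := E) x t :=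
    mfderiv_extChartAt_self _ _
  rw [e] at h
  exact h.congr_of_eventuallyEq (chartFieldAlong_comp_eventuallyEq hx.continuousAt)

variable [RiemannianBundle (fun (x : M) ↦ TangentSpace 𝓘(ℝ, E) x)] [FiniteDimensional ℝ E]

omit [IsManifold 𝓘(ℝ, E) ∞ M] in
theorem covDeriv_eq (X : ∀ q : M, TangentSpace 𝓘(ℝ, E) q) (p : M) (ξ : TangentSpace 𝓘(ℝ, E) p) :
    covDeriv X p ξ = (show TangentSpace 𝓘(ℝ, E) p from
      fderiv ℝ (chartField X p) (extChartAt 𝓘(ℝ, E) p p) ξ) + christoffel p ξ (X p) := rfl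

omit [IsManifold 𝓘(ℝ, E) ∞ M] in
theorem inner_covDeriv_smul (X : ∀ q : M, TangentSpace 𝓘(ℝ, E) q) (p : M) (c : ℝ)
    (ξ w : TangentSpace 𝓘(ℝ, E) p) :
    inner ℝ (covDeriv X p (c • ξ)) w = c * inner ℝ (covDeriv X p ξ) w := by
  have h1 : (show TangentSpace 𝓘(ℝ, E) p from
      fderiv ℝ (chartField X p) (extChartAt 𝓘(ℝ, E) p p) (c • ξ)) =
      c • (show TangentSpace 𝓘(ℝ, E) p from
      fderiv ℝ (chartField X p) (extChartAt 𝓘(ℝ, E) p p) ξ) :=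
    (fderiv ℝ (chartField X p) (extChartAt 𝓘(ℝ, E) p p)).map_smul c ξ
  have h2 : christoffelForm (E := E) (chartMetric p) (extChartAt 𝓘(ℝ, E) p p) (c • ξ) (X p) w =
      c * christoffelForm (E := E) (chartMetric p) (extChartAt 𝓘(ℝ, E) p p) ξ (X p) w :=
    christoffelForm_smul (E := E) _ _ c ξ (X p) w
  rw [covDeriv_eq, covDeriv_eq, inner_add_left, inner_add_left, inner_christoffel,
    inner_christoffel, h1, h2, inner_smul_left, mul_add]
  rfl

omit [IsManifold 𝓘(ℝ, E) ∞ M] in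
theorem minHessian_mul_norm_sq_le {U : M → ℝ} {p : M} (h : 0 < minHessian (E := E) U p)
    (ξ : TangentSpace 𝓘(ℝ, E) p) :
    minHessian (E := E) U p * ‖ξ‖ ^ 2 ≤ inner ℝ (covDeriv (grad (E := E) U) p ξ) ξ := by
  rcases eq_or_ne ξ 0 with rfl | hξ
  · simp
  have hn : ‖ξ‖ ≠ 0 := norm_ne_zero_iff.2 hξ
  have hbdd : BddBelow {r : ℝ | ∃ ξ : TangentSpace 𝓘(ℝ, E) p, ‖ξ‖ = 1 ∧
      r = inner ℝ (covDeriv (E := E) (grad (E := E) U) p ξ) ξ} := by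
    -- A real set unbounded below has `sInf` equal to 0, which the positivity hypothesis excludes.
    by_contra hb
    exact h.ne' (Real.sInf_of_not_bddBelow hb)
  obtain ⟨u, hu⟩ : ∃ u : TangentSpace 𝓘(ℝ, E) p, u = ‖ξ‖⁻¹ • ξ := ⟨_, rfl⟩
  have hξu : ξ = ‖ξ‖ • u := by rw [hu, smul_smul, mul_inv_cancel₀ hn, one_smul]
  have h1 : ‖u‖ = 1 := by rw [hu, norm_smul, norm_inv, norm_norm, inv_mul_cancel₀ hn]
  have h2 : minHessian (E := E) U p ≤ inner ℝ (covDeriv (grad (E := E) U) p u) u :=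
    csInf_le hbdd ⟨u, h1, rfl⟩
  have h3 : inner ℝ (covDeriv (grad (E := E) U) p ξ) ξ =
      ‖ξ‖ ^ 2 * inner ℝ (covDeriv (grad (E := E) U) p u) u := by
    generalize ‖ξ‖ = c at hξu
    subst hξu
    rw [inner_covDeriv_smul, inner_smul_right]
    ring
  rw [h3, mul_comm]
  exact mul_le_mul_of_nonneg_left h2 (sq_nonneg _)

omit [IsManifold 𝓘(ℝ, E) ∞ M] in
theorem hasDerivAt_comp_grad {U : M → ℝ} {x : ℝ → M} {t : ℝ}
    (hU : MDifferentiableAt 𝓘(ℝ, E) 𝓘(ℝ, ℝ) U (x t))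
    (hx : MDifferentiableAt 𝓘(ℝ, ℝ) 𝓘(ℝ, E) x t) :
    HasDerivAt (fun s ↦ U (x s)) (inner ℝ (grad (E := E) U (x t)) (velocity x t)) t := by
  have h2 : HasMFDerivAt 𝓘(ℝ, ℝ) 𝓘(ℝ, ℝ) (fun s ↦ U (x s)) t
      ((mfderiv 𝓘(ℝ, E) 𝓘(ℝ, ℝ) U (x t)).comp (mfderiv 𝓘(ℝ, ℝ) 𝓘(ℝ, E) x t)) :=
    hU.hasMFDerivAt.comp t hx.hasMFDerivAt
  have h3 : HasFDerivAt (fun s ↦ U (x s)) (_ : ℝ →L[ℝ] ℝ) t :=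
    hasMFDerivAt_iff_hasFDerivAt.1 h2
  refine h3.hasDerivAt.congr_deriv ?_
  rw [grad, inner_riesz]
  rfl

variable [IsContMDiffRiemannianBundle 𝓘(ℝ, E) ∞ E (fun (p : M) ↦ TangentSpace 𝓘(ℝ, E) p)]

/-- In the chart the gradient solves G(y) X(y) = d(U ∘ φ⁻¹)(y), where G is invertible and both G and
the right side are differentiable. -/
theorem differentiableAt_chartField_grad {U : M → ℝ} (hU : ContMDiff 𝓘(ℝ, E) 𝓘(ℝ, ℝ) ∞ U) (p : M) :
    DifferentiableAt ℝ (chartField (grad (E := E) U) p) (extChartAt 𝓘(ℝ, E) p p) := by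
  have htgt := extChartAt_target_mem_nhds (I := 𝓘(ℝ, E)) p
  have hUφ : ContDiffAt ℝ ∞ (fun y ↦ U ((extChartAt 𝓘(ℝ, E) p).symm y)) (extChartAt 𝓘(ℝ, E) p p) := by
    have h : ContMDiffOn 𝓘(ℝ, E) 𝓘(ℝ, ℝ) ∞ (fun y ↦ U ((extChartAt 𝓘(ℝ, E) p).symm y))
        (extChartAt 𝓘(ℝ, E) p).target := hU.comp_contMDiffOn (contMDiffOn_extChartAt_symm p)
    exact (contMDiffOn_iff_contDiffOn.1 h).contDiffAt htgt
  refine differentiableAt_of_clm_apply_eq (F := E →L[ℝ] ℝ)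
    (differentiableAt_chartMetric (E := E) p)
    (ℓ := fderiv ℝ (fun y ↦ U ((extChartAt 𝓘(ℝ, E) p).symm y)))
    ((hUφ.fderiv_right (m := ∞) le_rfl).differentiableAt (by simp)) ?_ ?_
  · filter_upwards [htgt] with y hy
    refine isInvertible_of_apply_self_eq_zero fun v hv ↦ ?_
    rw [chartMetric_apply] at hv
    have h0 := inner_self_eq_zero.1 hv
    have h1 := mfderiv_extChartAt_comp_symm hy v
    rw [h0, map_zero] at h1
    exact h1.symm
  · filter_upwards [htgt] with y hy
    ext w
    have hs := (extChartAt 𝓘(ℝ, E) p).map_target hy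
    have hsymm : MDifferentiableAt 𝓘(ℝ, E) 𝓘(ℝ, E) (extChartAt 𝓘(ℝ, E) p).symm y :=
      ((contMDiffOn_extChartAt_symm (I := 𝓘(ℝ, E)) (n := ∞) p).contMDiffAt
        ((isOpen_extChartAt_target p).mem_nhds hy)).mdifferentiableAt (by simp)
    have h2 : HasMFDerivAt 𝓘(ℝ, E) 𝓘(ℝ, ℝ) (fun y ↦ U ((extChartAt 𝓘(ℝ, E) p).symm y)) y
        ((mfderiv 𝓘(ℝ, E) 𝓘(ℝ, ℝ) U ((extChartAt 𝓘(ℝ, E) p).symm y)).comp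
          (mfderiv 𝓘(ℝ, E) 𝓘(ℝ, E) (extChartAt 𝓘(ℝ, E) p).symm y)) :=
      (hU.mdifferentiable (by simp) _).hasMFDerivAt.comp y hsymm.hasMFDerivAt
    have h3 : HasFDerivAt (fun y ↦ U ((extChartAt 𝓘(ℝ, E) p).symm y)) (_ : E →L[ℝ] ℝ) y :=
      hasMFDerivAt_iff_hasFDerivAt.1 h2
    rw [h3.fderiv]
    have h4 := chartMetric_mfderiv hs (grad (E := E) U _)
      (mfderiv 𝓘(ℝ, E) 𝓘(ℝ, E) (extChartAt 𝓘(ℝ, E) p).symm y w)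
    rw [grad, inner_riesz, (extChartAt 𝓘(ℝ, E) p).right_inv hy] at h4
    exact (congrArg (chartMetric p y _) (mfderiv_extChartAt_comp_symm hy w).symm).trans h4

/-- The second derivative of a function along a curve. -/
theorem hasDerivAt_inner_grad_velocity {U : M → ℝ} {x : ℝ → M}
    (hU : ContMDiff 𝓘(ℝ, E) 𝓘(ℝ, ℝ) ∞ U) (hx : ContMDiff 𝓘(ℝ, ℝ) 𝓘(ℝ, E) ∞ x) (t : ℝ) :
    HasDerivAt (fun s ↦ inner ℝ (grad (E := E) U (x s)) (velocity (E := E) x s))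
      (inner ℝ (covDeriv (grad (E := E) U) (x t) (velocity x t)) (velocity x t) +
        inner ℝ (grad (E := E) U (x t)) (covDerivAlong x (velocity x) t)) t := by
  have hxt := hx.mdifferentiable (by simp) t
  have hg := hasDerivAt_chartFieldAlong_comp hxt (differentiableAt_chartField_grad hU (x t))
  refine (hasDerivAt_inner_along (ξ := fun s ↦ grad (E := E) U (x s)) hxt hg.differentiableAt
    (differentiableAt_chartFieldAlong_velocity hx t)).congr_deriv ?_
  -- The derivative along x of a restricted field is its covariant derivative in direction ẋ, by the
  -- chain rule in the chart.
  have h : covDerivAlong x (fun s ↦ grad (E := E) U (x s)) t =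
      covDeriv (grad (E := E) U) (x t) (velocity x t) := by
    rw [covDeriv_eq, ← hg.deriv]
    rfl
  rw [h]

theorem hasDerivAt_norm_velocity_sq {x : ℝ → M} (hx : ContMDiff 𝓘(ℝ, ℝ) 𝓘(ℝ, E) ∞ x) (t : ℝ) :
    HasDerivAt (fun s ↦ ‖velocity (E := E) x s‖ ^ 2)
      (2 * inner ℝ (velocity x t) (covDerivAlong x (velocity (E := E) x) t)) t := by
  have hv := differentiableAt_chartFieldAlong_velocity hx t
  have h := hasDerivAt_inner_along (hx.mdifferentiable (by simp) t) hv hv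
  simp only [real_inner_self_eq_norm_sq] at h
  refine h.congr_deriv ?_
  rw [real_inner_comm (velocity x t), two_mul]

end RiemannCurve

/-! ### From the scalar estimate to the manifold. -/

theorem speed_sq_le_of_hessian_pos
    {E : Type*} [NormedAddCommGroup E] [NormedSpace ℝ E] [FiniteDimensional ℝ E]
    {M : Type*} [TopologicalSpace M] [ChartedSpace E M] [IsManifold 𝓘(ℝ, E) ∞ M]
    [RiemannianBundle (fun (p : M) ↦ TangentSpace 𝓘(ℝ, E) p)]
    [IsContMDiffRiemannianBundle 𝓘(ℝ, E) ∞ E (fun (p : M) ↦ TangentSpace 𝓘(ℝ, E) p)]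
    {x : ℝ → M} {U : M → ℝ} {lam A B ζ : ℝ} (hx : ContMDiff 𝓘(ℝ, ℝ) 𝓘(ℝ, E) ∞ x)
    (hU : ContMDiff 𝓘(ℝ, E) 𝓘(ℝ, ℝ) ∞ U)
    (hA : ∀ t, ‖covDerivAlong (E := E) x (velocity x) t‖ ≤ A)
    (hB : ∀ t, ‖grad (E := E) U (x t)‖ ≤ B) (hB0 : 0 < B) (hlam : 0 < lam)
    (hmin : ∀ t, lam ≤ minHessian (E := E) U (x t))
    (hbdd : BddAbove (Set.range fun t : ℝ ↦ U (x t)))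
    (hζ : 0 < ζ) (hroot : ζ ^ 3 - 3 * ζ - 1 = 0) (t : ℝ) :
    lam * ‖velocity (E := E) x t‖ ^ 2 ≤ ζ ^ 2 * (A * B) := by
  have hA0 : 0 ≤ A := (norm_nonneg _).trans (hA 0)
  -- A may be 0 (a geodesic), while the scalar argument divides by it; hence a larger A' and a
  -- limit.
  have key : ∀ A', A < A' → lam * ‖velocity (E := E) x t‖ ^ 2 ≤ ζ ^ 2 * (A' * B) := by
    intro A' hA'
    have hA'0 : 0 < A' := hA0.trans_lt hA'
    refine speed_sq_le (v := fun s ↦ ‖velocity (E := E) x s‖) hlam hA'0 hB0 hζ hroot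
      (abs_sub_le_of_hasDerivAt_sq hA'0.le (fun _ ↦ norm_nonneg _)
        (fun s ↦ hasDerivAt_norm_velocity_sq hx s) fun s ↦ ?_)
      (fun s ↦ hasDerivAt_comp_grad (hU.mdifferentiable (by simp) _)
        (hx.mdifferentiable (by simp) s))
      (fun s ↦ hasDerivAt_inner_grad_velocity hU hx s) (fun s ↦ ?_) (fun s ↦ ?_) hbdd t
    · rw [abs_mul, abs_two]
      refine mul_le_mul_of_nonneg_left ((abs_real_inner_le_norm _ _).trans ?_) zero_le_two
      rw [mul_comm]
      exact mul_le_mul_of_nonneg_right ((hA s).trans hA'.le) (norm_nonneg _)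
    · exact (abs_real_inner_le_norm _ _).trans (mul_le_mul_of_nonneg_right (hB s) (norm_nonneg _))
    · have h1 := minHessian_mul_norm_sq_le (hlam.trans_le (hmin s)) (velocity (E := E) x s)
      have h2 := mul_le_mul_of_nonneg_right (hmin s) (sq_nonneg ‖velocity (E := E) x s‖)
      have h3 := neg_le_of_abs_le (abs_real_inner_le_norm (grad (E := E) U (x s))
        (covDerivAlong (E := E) x (velocity x) s))
      have h4 := mul_le_mul (hB s) ((hA s).trans hA'.le) (norm_nonneg _) hB0.le
      linarith
  have hlim : Filter.Tendsto (fun A' ↦ ζ ^ 2 * (A' * B)) (nhdsWithin A (Set.Ioi A))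
      (nhds (ζ ^ 2 * (A * B))) :=
    (by fun_prop : Continuous fun A' ↦ ζ ^ 2 * (A' * B)).tendsto A |>.mono_left nhdsWithin_le_nhds
  exact ge_of_tendsto hlim (by filter_upwards [self_mem_nhdsWithin] with A' h using key A' h)

theorem theorem1 :
    ∃ ζ : ℝ, (0 < ζ ∧ ζ ^ 3 - 3 * ζ - 1 = 0 ∧ (∀ z : ℝ, 0 < z → z ^ 3 - 3 * z - 1 = 0 → z = ζ) ∧
      |ζ - 1.879| < 0.0005) ∧
    ∃ C : ℝ, 0 < C ∧ C ≤ ζ ∧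
      ∀ (E : Type*) [NormedAddCommGroup E] [NormedSpace ℝ E] [FiniteDimensional ℝ E]
        (M : Type*) [EMetricSpace M] [CompleteSpace M] [ChartedSpace E M]
        [IsManifold 𝓘(ℝ, E) ∞ M]
        [RiemannianBundle (fun (p : M) ↦ TangentSpace 𝓘(ℝ, E) p)]
        [IsContMDiffRiemannianBundle 𝓘(ℝ, E) ∞ E (fun (p : M) ↦ TangentSpace 𝓘(ℝ, E) p)]
        [IsRiemannianManifold 𝓘(ℝ, E) M]
        (x : ℝ → M) (U : M → ℝ) (lam : ℝ),
        ContMDiff 𝓘(ℝ, ℝ) 𝓘(ℝ, E) ∞ x →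
        ContMDiff 𝓘(ℝ, E) 𝓘(ℝ, ℝ) ∞ U →
        BddAbove (Set.range fun t : ℝ ↦ ‖covDerivAlong (E := E) x (velocity x) t‖) →
        BddAbove (Set.range fun t : ℝ ↦ U (x t)) →
        BddAbove (Set.range fun t : ℝ ↦ ‖grad (E := E) U (x t)‖) →
        0 < ⨆ t : ℝ, ‖grad (E := E) U (x t)‖ →
        lam = ⨅ t : ℝ, minHessian (E := E) U (x t) →
        0 < lam →
        BddAbove (Set.range fun t : ℝ ↦ ‖velocity (E := E) x t‖) ∧
        (⨆ t : ℝ, ‖velocity (E := E) x t‖) ^ 2 ≤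
          C ^ 2 / lam * (⨆ t : ℝ, ‖grad (E := E) U (x t)‖) *
            ⨆ t : ℝ, ‖covDerivAlong (E := E) x (velocity x) t‖ := by
  obtain ⟨ζ, hζ, hroot, huniq, happrox⟩ := exists_cubic_root
  refine ⟨ζ, ⟨hζ, hroot, huniq, happrox⟩, ζ, hζ, le_rfl, ?_⟩
  intro E _ _ _ M _ _ _ _ _ _ _ x U lam hx hU hA hUb hB hB0 hlam hlam0
  -- An infimum unbounded below would take the default value 0, contradicting λ > 0.
  have hbelow : BddBelow (Set.range fun t : ℝ ↦ minHessian (E := E) U (x t)) := by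
    by_contra h
    rw [hlam, Real.iInf_of_not_bddBelow h] at hlam0
    exact lt_irrefl _ hlam0
  have hsq : ∀ t, ‖velocity (E := E) x t‖ ^ 2 ≤
      ζ ^ 2 / lam * (⨆ t : ℝ, ‖grad (E := E) U (x t)‖) *
        ⨆ t : ℝ, ‖covDerivAlong (E := E) x (velocity x) t‖ := fun t ↦ by
    have h := speed_sq_le_of_hessian_pos hx hU (fun s ↦ le_ciSup hA s) (fun s ↦ le_ciSup hB s)
      hB0 hlam0 (fun s ↦ hlam ▸ ciInf_le hbelow s) hUb hζ hroot t
    rw [div_mul_eq_mul_div, div_mul_eq_mul_div, le_div_iff₀ hlam0]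
    linarith
  have hle := fun t ↦ Real.le_sqrt_of_sq_le (hsq t)
  refine ⟨⟨_, Set.forall_mem_range.2 hle⟩, ?_⟩
  rw [← Real.le_sqrt (Real.iSup_nonneg fun _ ↦ norm_nonneg _) ((sq_nonneg _).trans (hsq 0))]
  exact ciSup_le hle
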